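/- Let $G$ be a group equipped with a bi-invariant metric $d$, i.e. $d(axb,ayb)=d(x,y)$ for all $a,b,x,y\in G$, and topologized by $d$ (so that $G$ is a topological group and $d$ is a compatible metric). For a set $I$ let $F_I$ denote the free group with free generating set $I$, and regard $G$ and $F_I$ as subgroups (the free factors) of the free product $G\ast F_I$. Write $F_\infty=F_{\mathbb N}$. 1. If $G$ is separable, then there is a bi-invariant metric $\bar d$ on $G\ast F_\infty$ which extends $d$ and for which $F_\infty$ is dense in $(G\ast F_\infty,\bar d)$. If moreover $d\le K$ for some real constant $K>0$, then $\bar d$ can be chosen so that, in addition, $\bar d\le K$. 2. Let $\kappa\ge\aleph_0$ be the density of $(G,d)$, i.e. the least cardinality of a dense subset of $G$ (assumed here to be infinite), and let $I$ be a set of cardinality $\kappa$. Then there is a bi-invariant metric $\bar d$ on $G\ast F_I$ which extends $d$ and for which $F_I$ is dense in $(G\ast F_I,\bar d)$; in particular, $(G,d)$ is isometrically contained as a subgroup in a group with bi-invariant metric which has the free group on $\kappa$ generators as a dense subgroup. If moreover $d\le K$ for some real constant $K>0$, then $\bar d$ can be chosen so that, in addition, $\bar d\le K$. -/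

import Mathlib

open Cardinal TopologicalSpace

universe u

/-- The metric of the metric group `G` is bi-invariant: invariant under all left and
all right translations. -/
def IsBiInvariant (G : Type u) [Group G] [MetricSpace G] : Prop :=
  ∀ a b x y : G, dist (a * x * b) (a * y * b) = dist x y

/-- The density of a topological space: the least cardinality of a dense subset. -/
noncomputable def density (X : Type u) [TopologicalSpace X] : Cardinal.{u} :=
  sInf {c : Cardinal.{u} | ∃ s : Set X, Dense s ∧ #s = c}

/-! A bi-invariant metric is the same thing as a conjugation-invariant norm. Such norms on the
factors of a free product extend to it by `freeProductNorm`, the infimal cost of reducing a word.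
Replacing a word by its normal form never raises the cost (`mul_adjacent`, `remove_one`), and a
nonempty normal form must begin by deleting a letter, so the infimum is positive and restricts
correctly. Apply this to `G` and cyclic groups with generators `t i` of norm `r i`. Sending the free
generator `x i` to `g i * t i` embeds `G ∗ F_ι`, and the pulled-back norm puts `x i` at distance `r
i` from `g i`. If the pairs `(g i, r i)` run over a dense set times `{1/(n+1)}`, the closure of
`F_ι` contains `G`, hence everything. Taking the minimum with `K` gives the bounded version. -/

open Monoid

/-! ### Conjugation-invariant norms and their metrics. -/

/-- A conjugation-invariant norm on a group. -/
structure IsInvariantNorm {H : Type*} [Group H] (N : H → ℝ) : Prop where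
  one : N 1 = 0
  pos : ∀ x, x ≠ 1 → 0 < N x
  inv : ∀ x, N x⁻¹ = N x
  mul_le : ∀ x y, N (x * y) ≤ N x + N y
  conj : ∀ c x, N (c * x * c⁻¹) = N x

namespace IsInvariantNorm

variable {H : Type*} [Group H] {N : H → ℝ}

theorem nonneg (hN : IsInvariantNorm N) (x : H) : 0 ≤ N x := by
  by_cases h : x = 1
  · rw [h, hN.one]
  · exact (hN.pos x h).le

theorem conj_inv (hN : IsInvariantNorm N) (c x : H) : N (c⁻¹ * x * c) = N x := by
  simpa using hN.conj c⁻¹ x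

theorem comap (hN : IsInvariantNorm N) {H' : Type*} [Group H'] (f : H' →* H)
    (hf : Function.Injective f) : IsInvariantNorm fun x => N (f x) where
  one := by simp [hN.one]
  pos x hx := hN.pos _ (by simpa [map_eq_one_iff f hf] using hx)
  inv x := by simp [hN.inv]
  mul_le x y := by simpa using hN.mul_le (f x) (f y)
  conj c x := by simpa using hN.conj (f c) (f x)

theorem truncate (hN : IsInvariantNorm N) {K : ℝ} (hK : 0 < K) :
    IsInvariantNorm fun x => min (N x) K where
  one := by simp [hN.one, hK.le]
  pos x hx := lt_min (hN.pos x hx) hK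
  inv x := by simp [hN.inv]
  mul_le x y := by
    have h := hN.mul_le x y
    have hx := hN.nonneg x
    have hy := hN.nonneg y
    rcases min_cases (N x) K with h1 | h1 <;> rcases min_cases (N y) K with h2 | h2 <;>
      rcases min_cases (N (x * y)) K with h3 | h3 <;> linarith
  conj c x := by simp [hN.conj]

/-- The metric `dist x y = N (x⁻¹ * y)` of an invariant norm. -/
abbrev metricSpace (hN : IsInvariantNorm N) : MetricSpace H where
  dist x y := N (x⁻¹ * y)
  dist_self x := by simp [hN.one]
  dist_comm x y := by simpa using hN.inv (y⁻¹ * x)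
  dist_triangle x y z := by simpa [mul_assoc] using hN.mul_le (x⁻¹ * y) (y⁻¹ * z)
  eq_of_dist_eq_zero {x y} h := by
    by_contra hxy
    exact (hN.pos (x⁻¹ * y) (by rwa [Ne, inv_mul_eq_one])).ne' h

theorem isBiInvariant_dist (hN : IsInvariantNorm N) (a b x y : H) :
    N ((a * x * b)⁻¹ * (a * y * b)) = N (x⁻¹ * y) := by
  rw [← hN.conj_inv b (x⁻¹ * y)]
  congr 1
  group

end IsInvariantNorm

/-- Locates a marked letter relative to the letter a reduction step acts on. -/
theorem List.append_cons_cases {α : Type*} {A B C D : List α} {x y : α}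
    (h : A ++ x :: B = C ++ y :: D) :
    (A = C ∧ x = y ∧ B = D) ∨ (∃ E, A = C ++ y :: E ∧ D = E ++ x :: B) ∨
      ∃ E, C = A ++ x :: E ∧ B = E ++ y :: D := by
  rcases List.append_eq_append_iff.1 h with ⟨_ | ⟨e, E⟩, rfl, hE⟩ | ⟨_ | ⟨e, E⟩, rfl, hE⟩ <;>
    simp_all

/-! ### The norm on a free product. -/

section FreeProduct

variable {ι : Type*} {M : ι → Type*} [∀ i, Group (M i)]

/-- `ReducesWithCost N L r`: the word `L` can be reduced to the empty word, at total cost at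
most `r`, by deleting letters `g` at cost `N g` and multiplying adjacent letters from the same
group at no cost. -/
inductive ReducesWithCost (N : ∀ i, M i → ℝ) : List (Σ i, M i) → ℝ → Prop
  | nil {r : ℝ} : 0 ≤ r → ReducesWithCost N [] r
  | delete {A B : List (Σ i, M i)} {i : ι} {g : M i} {r : ℝ} :
      ReducesWithCost N (A ++ B) r → ReducesWithCost N (A ++ ⟨i, g⟩ :: B) (r + N i g)
  | merge {A B : List (Σ i, M i)} {i : ι} {g h : M i} {r : ℝ} :
      ReducesWithCost N (A ++ ⟨i, g * h⟩ :: B) r →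
        ReducesWithCost N (A ++ ⟨i, g⟩ :: ⟨i, h⟩ :: B) r

namespace ReducesWithCost

variable {N : ∀ i, M i → ℝ}

theorem mono {L : List (Σ i, M i)} {r s : ℝ} (h : ReducesWithCost N L r) (hrs : r ≤ s) :
    ReducesWithCost N L s := by
  induction h generalizing s with
  | nil h0 => exact nil (h0.trans hrs)
  | @delete A B i g r _ ih =>
    rw [← sub_add_cancel s (N i g)]
    exact delete (ih (by linarith))
  | merge _ ih => exact merge (ih hrs)

theorem nonneg (hN : ∀ i, IsInvariantNorm (N i)) {L : List (Σ i, M i)} {r : ℝ}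
    (h : ReducesWithCost N L r) : 0 ≤ r := by
  induction h with
  | nil h0 => exact h0
  | @delete A B i g r _ ih => exact add_nonneg ih ((hN i).nonneg g)
  | merge _ ih => exact ih

theorem insert {L A B : List (Σ i, M i)} {r s : ℝ} (h : ReducesWithCost N L s)
    (h' : ReducesWithCost N (A ++ B) r) : ReducesWithCost N (A ++ L ++ B) (r + s) := by
  induction h with
  | nil h0 => simpa using h'.mono (by linarith)
  | @delete C D i g s _ ih =>
    have := delete (N := N) (A := A ++ C) (B := D ++ B) (g := g) (by simpa using ih)
    simpa [add_assoc] using this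
  | @merge C D i g h s _ ih =>
    have := merge (N := N) (A := A ++ C) (B := D ++ B) (g := g) (h := h) (by simpa using ih)
    simpa using this

theorem append {L L' : List (Σ i, M i)} {r s : ℝ} (h : ReducesWithCost N L r)
    (h' : ReducesWithCost N L' s) : ReducesWithCost N (L ++ L') (r + s) := by
  simpa using h'.insert (A := L) (B := []) (by simpa using h)

theorem singleton (i : ι) (g : M i) : ReducesWithCost N [⟨i, g⟩] (N i g) := by
  simpa using delete (N := N) (A := []) (B := []) (g := g) (nil le_rfl)

/-- Once `L` is gone, `g` and `g⁻¹` merge into `1`, whose deletion is free. -/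
theorem conj (hN : ∀ i, IsInvariantNorm (N i)) {L : List (Σ i, M i)} {r : ℝ}
    (h : ReducesWithCost N L r) (i : ι) (g : M i) :
    ReducesWithCost N (⟨i, g⟩ :: L ++ [⟨i, g⁻¹⟩]) r := by
  have h0 : ReducesWithCost N [⟨i, g⟩, ⟨i, g⁻¹⟩] 0 := by
    refine merge (A := []) (B := []) ?_
    simpa [(hN i).one] using singleton (N := N) i (1 : M i)
  simpa using h.insert (A := [⟨i, g⟩]) (B := [⟨i, g⁻¹⟩]) (r := 0) (by simpa using h0)

/-- The element of the free product represented by a word. -/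
def wordProd (L : List (Σ i, M i)) : Monoid.CoprodI M :=
  (L.map fun l => Monoid.CoprodI.of l.2).prod

theorem wordProd_append (L L' : List (Σ i, M i)) :
    wordProd (L ++ L') = wordProd L * wordProd L' := by
  simp [wordProd]

/-- The word of inverses, in the reverse order. -/
def inverseWord (L : List (Σ i, M i)) : List (Σ i, M i) :=
  (L.map fun x => ⟨x.1, x.2⁻¹⟩).reverse

theorem wordProd_inverseWord (L : List (Σ i, M i)) :
    wordProd (inverseWord L) = (wordProd L)⁻¹ := by
  induction L with
  | nil => simp [wordProd, inverseWord]
  | cons l L ih => simpa [wordProd, inverseWord] using ih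

theorem inverse (hN : ∀ i, IsInvariantNorm (N i)) {L : List (Σ i, M i)} {r : ℝ}
    (h : ReducesWithCost N L r) : ReducesWithCost N (inverseWord L) r := by
  induction h with
  | nil h0 => exact nil h0
  | @delete A B i g r _ ih =>
    rw [← (hN i).inv g]
    have := delete (N := N) (A := inverseWord B) (B := inverseWord A) (g := g⁻¹)
      (by simpa [inverseWord] using ih)
    simpa [inverseWord] using this
  | @merge A B i g h r _ ih =>
    have := merge (N := N) (A := inverseWord B) (B := inverseWord A) (g := h⁻¹) (h := g⁻¹)
      (by simpa [inverseWord] using ih)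
    simpa [inverseWord] using this

/-- Run the same reduction with `z` for `y`. A merge on the right keeps `z * y⁻¹`, one on the left
conjugates it, and the final deletion uses the triangle inequality. -/
theorem perturb (hN : ∀ i, IsInvariantNorm (N i)) {A B : List (Σ i, M i)} {i : ι} {y : M i}
    {r : ℝ} (h : ReducesWithCost N (A ++ ⟨i, y⟩ :: B) r) (z : M i) :
    ReducesWithCost N (A ++ ⟨i, z⟩ :: B) (r + N i (z * y⁻¹)) := by
  generalize hL : A ++ ⟨i, y⟩ :: B = L at h
  induction h generalizing A B y z with
  | nil _ => simp at hL
  | @delete C D j g r hr ih =>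
    rcases List.append_cons_cases hL with ⟨rfl, he, rfl⟩ | ⟨E, rfl, rfl⟩ | ⟨E, rfl, rfl⟩
    · cases he
      refine (delete hr).mono ?_
      have := (hN i).mul_le (z * y⁻¹) y
      simp only [inv_mul_cancel_right] at this
      linarith
    · have := delete (g := g) (A := C) (B := E ++ ⟨i, z⟩ :: B)
        (by simpa using ih (A := C ++ E) (B := B) (y := y) z (by simp))
      simpa [add_right_comm] using this
    · have := delete (g := g) (A := A ++ ⟨i, z⟩ :: E) (B := D)
        (by simpa using ih (A := A) (B := E ++ D) (y := y) z (by simp))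
      simpa [add_right_comm] using this
  | @merge C D j g h r hr ih =>
    rcases List.append_cons_cases hL with ⟨rfl, he, rfl⟩ | ⟨E, rfl, hE⟩ | ⟨E, rfl, rfl⟩
    · cases he
      exact merge (by simpa [mul_assoc] using ih (z * h) rfl)
    · rcases E with _ | ⟨e, E⟩
      · simp only [List.nil_append, List.cons.injEq] at hE
        obtain ⟨he, rfl⟩ := hE
        cases he
        have h1 : g * z * (g * y)⁻¹ = g * (z * y⁻¹) * g⁻¹ := by group
        have h2 := ih (g * z) rfl
        rw [h1, (hN i).conj] at h2
        simpa using merge h2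
      · simp only [List.cons_append, List.cons.injEq] at hE
        obtain ⟨rfl, rfl⟩ := hE
        have := merge (g := g) (h := h) (A := C) (B := E ++ ⟨i, z⟩ :: B)
          (by simpa using ih (A := C ++ ⟨j, g * h⟩ :: E) (B := B) (y := y) z (by simp))
        simpa using this
    · have := merge (g := g) (h := h) (A := A ++ ⟨i, z⟩ :: E) (B := D)
        (by simpa using ih (A := A) (B := E ++ ⟨j, g * h⟩ :: D) (y := y) z (by simp))
      simpa using this

theorem remove_one (hN : ∀ i, IsInvariantNorm (N i)) {A B : List (Σ i, M i)} {i : ι}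
    {r : ℝ} (h : ReducesWithCost N (A ++ ⟨i, 1⟩ :: B) r) : ReducesWithCost N (A ++ B) r := by
  generalize hL : A ++ ⟨i, 1⟩ :: B = L at h
  induction h generalizing A B with
  | nil _ => simp at hL
  | @delete C D j g r hr ih =>
    rcases List.append_cons_cases hL with ⟨rfl, he, rfl⟩ | ⟨E, rfl, rfl⟩ | ⟨E, rfl, rfl⟩
    · cases he
      exact hr.mono (by simp [(hN i).one])
    · have := delete (g := g) (A := C) (B := E ++ B)
        (by simpa using ih (A := C ++ E) (B := B) (by simp))
      simpa using this
    · have := delete (g := g) (A := A ++ E) (B := D)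
        (by simpa using ih (A := A) (B := E ++ D) (by simp))
      simpa using this
  | @merge C D j g h r hr ih =>
    rcases List.append_cons_cases hL with ⟨rfl, he, rfl⟩ | ⟨E, rfl, hE⟩ | ⟨E, rfl, rfl⟩
    · cases he
      simpa using hr
    · rcases E with _ | ⟨e, E⟩
      · simp only [List.nil_append, List.cons.injEq] at hE
        obtain ⟨he, rfl⟩ := hE
        cases he
        simpa using hr
      · simp only [List.cons_append, List.cons.injEq] at hE
        obtain ⟨rfl, rfl⟩ := hE
        have := merge (g := g) (h := h) (A := C) (B := E ++ B)
          (by simpa using ih (A := C ++ ⟨j, g * h⟩ :: E) (B := B) (by simp))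
        simpa using this
    · have := merge (g := g) (h := h) (A := A ++ E) (B := D)
        (by simpa using ih (A := A) (B := E ++ ⟨j, g * h⟩ :: D) (by simp))
      simpa using this

/-- If the reduction deletes `x` or `y`, `perturb` turns the surviving letter into `x * y` at the
price of that deletion: `x * y * y⁻¹` is `x`, and `x * y * x⁻¹` is a conjugate of `y`. Merges with
neighbours are handled by associativity. -/
theorem mul_adjacent (hN : ∀ i, IsInvariantNorm (N i)) {A B : List (Σ i, M i)} {i : ι}
    {x y : M i} {r : ℝ} (h : ReducesWithCost N (A ++ ⟨i, x⟩ :: ⟨i, y⟩ :: B) r) :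
    ReducesWithCost N (A ++ ⟨i, x * y⟩ :: B) r := by
  generalize hL : A ++ ⟨i, x⟩ :: ⟨i, y⟩ :: B = L at h
  induction h generalizing A B x y with
  | nil _ => simp at hL
  | @delete C D j g r hr ih =>
    rcases List.append_cons_cases hL with ⟨rfl, he, rfl⟩ | ⟨E, rfl, rfl⟩ | ⟨E, rfl, hE⟩
    · cases he
      simpa using hr.perturb hN (x * y)
    · have := delete (g := g) (A := C) (B := E ++ ⟨i, x * y⟩ :: B)
        (by simpa using ih (A := C ++ E) (B := B) (x := x) (y := y) (by simp))
      simpa using this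
    · rcases E with _ | ⟨e, E⟩
      · simp only [List.nil_append, List.cons.injEq] at hE
        obtain ⟨he, rfl⟩ := hE
        cases he
        have := perturb hN (A := A) (y := x) (by simpa using hr) (x * y)
        rwa [(hN i).conj] at this
      · simp only [List.cons_append, List.cons.injEq] at hE
        obtain ⟨rfl, rfl⟩ := hE
        have := delete (g := g) (A := A ++ ⟨i, x * y⟩ :: E) (B := D)
          (by simpa using ih (A := A) (B := E ++ D) (x := x) (y := y) (by simp))
        simpa using this
  | @merge C D j g h r hr ih =>
    rcases List.append_cons_cases hL with ⟨rfl, he, hB⟩ | ⟨E, rfl, hE⟩ | ⟨E, rfl, hE⟩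
    · cases he
      simp only [List.cons.injEq] at hB
      obtain ⟨he, rfl⟩ := hB
      cases he
      exact hr
    · rcases E with _ | ⟨e, E⟩
      · simp only [List.nil_append, List.cons.injEq] at hE
        obtain ⟨he, rfl⟩ := hE
        cases he
        have := ih (A := C) (B := B) (x := g * x) (y := y) rfl
        rw [mul_assoc] at this
        simpa using merge this
      · simp only [List.cons_append, List.cons.injEq] at hE
        obtain ⟨rfl, rfl⟩ := hE
        have := merge (g := g) (h := h) (A := C) (B := E ++ ⟨i, x * y⟩ :: B)
          (by simpa using ih (A := C ++ ⟨j, g * h⟩ :: E) (B := B) (x := x) (y := y) (by simp))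
        simpa using this
    · rcases E with _ | ⟨e, E⟩
      · simp only [List.nil_append, List.cons.injEq] at hE
        obtain ⟨he, rfl⟩ := hE
        cases he
        have := ih (A := A) (B := D) (x := x) (y := y * h) (by simp)
        rw [← mul_assoc] at this
        exact merge this
      · simp only [List.cons_append, List.cons.injEq] at hE
        obtain ⟨rfl, rfl⟩ := hE
        have := merge (g := g) (h := h) (A := A ++ ⟨i, x * y⟩ :: E) (B := D)
          (by simpa using ih (A := A) (B := E ++ ⟨j, g * h⟩ :: D) (x := x) (y := y) (by simp))
        simpa using this

theorem exists_word (hN : ∀ i, IsInvariantNorm (N i)) {L : List (Σ i, M i)} {r : ℝ}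
    (h : ReducesWithCost N L r) :
    ∃ w : Monoid.CoprodI.Word M, w.prod = wordProd L ∧ ReducesWithCost N w.toList r := by
  induction hn : L.length using Nat.strong_induction_on generalizing L with
  | _ n ih =>
    subst hn
    by_cases h1 : ∀ l ∈ L, Sigma.snd l ≠ 1
    · by_cases h2 : L.IsChain fun l l' => Sigma.fst l ≠ Sigma.fst l'
      · exact ⟨⟨L, h1, h2⟩, rfl, h⟩
      · rw [List.isChain_iff_forall_rel_of_append_cons_cons] at h2
        push Not at h2
        obtain ⟨⟨i, x⟩, ⟨j, y⟩, A, B, rfl, hij⟩ := h2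
        obtain rfl : i = j := hij
        obtain ⟨w, hw, hwr⟩ := ih _ (by simp) (h.mul_adjacent hN) rfl
        exact ⟨w, by simp [hw, wordProd, mul_assoc], hwr⟩
    · push Not at h1
      obtain ⟨⟨i, x⟩, hx, hx1⟩ := h1
      obtain rfl : x = 1 := hx1
      obtain ⟨A, B, rfl⟩ := List.append_of_mem hx
      obtain ⟨w, hw, hwr⟩ := ih _ (by simp) (h.remove_one hN) rfl
      exact ⟨w, by simp [hw, wordProd], hwr⟩

/-- Adjacent letters of a normal form lie in different factors, so the first step can only be a
deletion. -/
theorem exists_norm_le (hN : ∀ i, IsInvariantNorm (N i)) {w : Monoid.CoprodI.Word M} {r : ℝ}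
    (h : ReducesWithCost N w.toList r) (hw : w.toList ≠ []) :
    ∃ l ∈ w.toList, N l.1 l.2 ≤ r := by
  generalize hL : w.toList = L at h hw ⊢
  cases h with
  | nil _ => simp at hw
  | @delete A B i g r hr => exact ⟨⟨i, g⟩, by simp, by simpa using hr.nonneg hN⟩
  | @merge A B i g h r hr =>
    have := w.chain_ne
    rw [hL, List.isChain_iff_forall_rel_of_append_cons_cons] at this
    exact (this rfl rfl).elim

end ReducesWithCost

/-- The least cost of reducing a word representing an element of the free product. -/
noncomputable def freeProductNorm (N : ∀ i, M i → ℝ) (x : CoprodI M) : ℝ :=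
  sInf {r | ∃ L, ReducesWithCost.wordProd L = x ∧ ReducesWithCost N L r}

theorem ReducesWithCost.freeProductNorm_le {N : ∀ i, M i → ℝ} (hN : ∀ i, IsInvariantNorm (N i))
    {L : List (Σ i, M i)} {r : ℝ} (h : ReducesWithCost N L r) :
    freeProductNorm N (wordProd L) ≤ r :=
  csInf_le ⟨0, by rintro _ ⟨L, -, h⟩; exact h.nonneg hN⟩ ⟨L, rfl, h⟩

theorem exists_reducesWithCost (N : ∀ i, M i → ℝ) (x : CoprodI M) :
    ∃ L r, ReducesWithCost.wordProd L = x ∧ ReducesWithCost N L r := by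
  induction x using CoprodI.induction_on with
  | one => exact ⟨[], 0, by simp [ReducesWithCost.wordProd], .nil le_rfl⟩
  | of i m => exact ⟨_, _, by simp [ReducesWithCost.wordProd], .singleton i m⟩
  | mul x y hx hy =>
    obtain ⟨L, r, rfl, h⟩ := hx
    obtain ⟨L', r', rfl, h'⟩ := hy
    exact ⟨_, _, by simp [ReducesWithCost.wordProd], h.append h'⟩

theorem exists_reducesWithCost_lt (N : ∀ i, M i → ℝ) {x : CoprodI M} {s : ℝ}
    (hs : freeProductNorm N x < s) :
    ∃ L r, ReducesWithCost.wordProd L = x ∧ ReducesWithCost N L r ∧ r < s := by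
  have hne : {r | ∃ L, ReducesWithCost.wordProd L = x ∧ ReducesWithCost N L r}.Nonempty := by
    obtain ⟨L, r, h⟩ := exists_reducesWithCost N x
    exact ⟨r, L, h⟩
  obtain ⟨r, ⟨L, h, h'⟩, hr⟩ := exists_lt_of_csInf_lt hne hs
  exact ⟨L, r, h, h', hr⟩

/-- The infimum need not be known to be attained: the smallest letter norm of `w` bounds every cost
from below. -/
theorem exists_norm_le_freeProductNorm {N : ∀ i, M i → ℝ} (hN : ∀ i, IsInvariantNorm (N i))
    {w : CoprodI.Word M} (hw : w.toList ≠ []) :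
    ∃ l ∈ w.toList, N l.1 l.2 ≤ freeProductNorm N w.prod := by
  classical
  by_contra! hlt
  obtain ⟨l, hl, hmin⟩ := Set.exists_min_image {l | l ∈ w.toList} (fun l => N l.1 l.2)
    w.toList.finite_toSet (List.exists_mem_of_ne_nil _ hw)
  obtain ⟨L, r, hL, h, hr⟩ := exists_reducesWithCost_lt N (hlt l hl)
  obtain ⟨w', hw', h'⟩ := h.exists_word hN
  -- Normal forms are unique.
  obtain rfl : w' = w := CoprodI.Word.equiv.symm.injective (hw'.trans hL)
  obtain ⟨l', hl', hle⟩ := h'.exists_norm_le hN hw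
  linarith [hmin l' hl']

theorem freeProductNorm_one {N : ∀ i, M i → ℝ} (hN : ∀ i, IsInvariantNorm (N i)) :
    freeProductNorm N 1 = 0 := by
  apply le_antisymm
  · exact (ReducesWithCost.nil le_rfl).freeProductNorm_le hN
  · exact Real.sInf_nonneg (by rintro _ ⟨L, -, h⟩; exact h.nonneg hN)

theorem freeProductNorm_of {N : ∀ i, M i → ℝ} (hN : ∀ i, IsInvariantNorm (N i)) {i : ι}
    (g : M i) : freeProductNorm N (CoprodI.of g) = N i g := by
  apply le_antisymm
  · simpa [ReducesWithCost.wordProd] using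
      (ReducesWithCost.singleton i g).freeProductNorm_le hN
  · by_cases hg : g = 1
    · simp [hg, (hN i).one, freeProductNorm_one hN]
    · obtain ⟨l, hl, h⟩ := exists_norm_le_freeProductNorm hN
        (w := ⟨[⟨i, g⟩], by simpa using hg, by simp⟩) (by simp)
      simp only [List.mem_singleton] at hl
      subst hl
      simpa [CoprodI.Word.prod] using h

theorem isInvariantNorm_freeProductNorm {N : ∀ i, M i → ℝ}
    (hN : ∀ i, IsInvariantNorm (N i)) : IsInvariantNorm (freeProductNorm N) := by
  have hinv (x) : freeProductNorm N x⁻¹ ≤ freeProductNorm N x := by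
    refine le_of_forall_gt fun s hs => ?_
    obtain ⟨L, r, rfl, h, hr⟩ := exists_reducesWithCost_lt N hs
    have := (h.inverse hN).freeProductNorm_le hN
    rw [ReducesWithCost.wordProd_inverseWord] at this
    exact this.trans_lt hr
  have hconj (c x) : freeProductNorm N (c * x * c⁻¹) ≤ freeProductNorm N x := by
    induction c using CoprodI.induction_on generalizing x with
    | one => simp
    | mul a b ha hb => simpa [mul_assoc] using (ha (b * x * b⁻¹)).trans (hb x)
    | of i g =>
      refine le_of_forall_gt fun s hs => ?_
      obtain ⟨L, r, rfl, h, hr⟩ := exists_reducesWithCost_lt N hs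
      have := (h.conj hN i g).freeProductNorm_le hN
      simp only [ReducesWithCost.wordProd, List.cons_append, List.map_cons, List.map_append,
        List.map_nil, List.prod_cons, List.prod_append, List.prod_nil, mul_one, map_inv,
        ← mul_assoc] at this
      exact this.trans_lt hr
  refine ⟨freeProductNorm_one hN, fun x hx => ?_, fun x => ?_, fun x y => ?_, fun c x => ?_⟩
  · classical
    obtain ⟨w, rfl⟩ := CoprodI.Word.equiv.symm.surjective x
    have hw : w.toList ≠ [] := by
      intro h
      exact hx (by simp [CoprodI.Word.equiv, CoprodI.Word.prod, h])
    obtain ⟨l, hl, h⟩ := exists_norm_le_freeProductNorm hN hw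
    exact ((hN l.1).pos _ (w.ne_one l hl)).trans_le h
  · exact (hinv x).antisymm (by simpa using hinv x⁻¹)
  · refine le_of_forall_pos_lt_add fun ε hε => ?_
    obtain ⟨L, r, rfl, h, hr⟩ :=
      exists_reducesWithCost_lt N (lt_add_of_pos_right (freeProductNorm N x) (half_pos hε))
    obtain ⟨L', r', rfl, h', hr'⟩ :=
      exists_reducesWithCost_lt N (lt_add_of_pos_right (freeProductNorm N y) (half_pos hε))
    have := (h.append h').freeProductNorm_le hN
    rw [ReducesWithCost.wordProd_append] at this
    linarith
  · exact (hconj c x).antisymm (by simpa [mul_assoc] using hconj c⁻¹ (c * x * c⁻¹))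

end FreeProduct

theorem IsBiInvariant.isInvariantNorm {G : Type*} [Group G] [MetricSpace G]
    (hG : IsBiInvariant G) : IsInvariantNorm fun x : G => dist 1 x where
  one := dist_self 1
  pos x hx := dist_pos.2 hx.symm
  inv x := by simpa [dist_comm] using (hG x 1 1 x⁻¹).symm
  mul_le x y := by
    have h : dist x (x * y) = dist 1 y := by simpa using hG x 1 1 y
    exact (dist_triangle 1 x (x * y)).trans_eq (by rw [h])
  conj c x := by simpa using hG c c⁻¹ 1 x

/-! ### Scaled absolute values on cyclic groups. -/

/-- The homomorphism from the free group on one generator to `ℤ`. -/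
def exponentHom : FreeGroup PUnit.{u + 1} →* Multiplicative ℤ :=
  FreeGroup.lift fun _ => Multiplicative.ofAdd 1

theorem exponentHom_injective : Function.Injective exponentHom.{u} := by
  have h : (zpowersHom _ (FreeGroup.of PUnit.unit)).comp exponentHom.{u} = MonoidHom.id _ := by
    ext
    simp [exponentHom]
  exact Function.LeftInverse.injective (g := zpowersHom _ (FreeGroup.of PUnit.unit))
    fun x => DFunLike.congr_fun h x

theorem isInvariantNorm_exponent {r : ℝ} (hr : 0 < r) :
    IsInvariantNorm fun x : Multiplicative ℤ => r * |(x.toAdd : ℝ)| where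
  one := by simp
  pos x hx := mul_pos hr (abs_pos.2 (by simpa using hx))
  inv x := by simp
  mul_le x y := by
    rw [← mul_add]
    refine mul_le_mul_of_nonneg_left ?_ hr.le
    simpa using abs_add_le (x.toAdd : ℝ) y.toAdd
  conj c x := by simp

/-! ### Twisting the free generators towards points of `G`. -/

section Twisted

variable {G : Type u} [Group G] {ι : Type*}

/-- The factors `G` and, for each `i : ι`, an infinite cyclic group. -/
def CyclicFactors (G : Type u) (ι : Type*) : Option ι → Type u
  | none => G
  | some _ => FreeGroup PUnit.{u + 1}

instance (j : Option ι) : Group (CyclicFactors G ι j) :=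
  match j with
  | none => inferInstanceAs (Group G)
  | some _ => inferInstanceAs (Group (FreeGroup PUnit.{u + 1}))

/-- The norms on the factors: the norm `N` on `G` and `r i` times the absolute value on the
`i`-th cyclic group. -/
def factorNorm (N : G → ℝ) (r : ι → ℝ) : ∀ j, CyclicFactors G ι j → ℝ
  | none => N
  | some i => fun x : FreeGroup PUnit.{u + 1} => r i * |((exponentHom x).toAdd : ℝ)|

theorem isInvariantNorm_factorNorm {N : G → ℝ} (hN : IsInvariantNorm N) {r : ι → ℝ}
    (hr : ∀ i, 0 < r i) (j : Option ι) : IsInvariantNorm (factorNorm N r j) :=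
  match j with
  | none => hN
  | some i => (isInvariantNorm_exponent (hr i)).comap exponentHom exponentHom_injective

/-- The inclusion of `G` in the free product. -/
def ofBase : G →* CoprodI (CyclicFactors G ι) :=
  CoprodI.of (M := CyclicFactors G ι) (i := none)

/-- The inclusion of the `i`-th cyclic group in the free product. -/
def ofCyclic (i : ι) : FreeGroup PUnit.{u + 1} →* CoprodI (CyclicFactors G ι) :=
  CoprodI.of (M := CyclicFactors G ι) (i := some i)

/-- The homomorphism that is the inclusion on `G` and sends the `i`-th free generator to `g i`
times the `i`-th cyclic generator. -/
def twist (g : ι → G) : Coprod G (FreeGroup ι) →* CoprodI (CyclicFactors G ι) :=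
  Coprod.lift ofBase (FreeGroup.lift fun i => ofBase (g i) * ofCyclic i (.of .unit))

/-- The left inverse of `twist`. -/
def untwist (g : ι → G) : CoprodI (CyclicFactors G ι) →* Coprod G (FreeGroup ι) :=
  CoprodI.lift fun
    | none => (Coprod.inl : G →* _)
    | some i => (FreeGroup.lift fun _ => Coprod.inl (g i)⁻¹ * Coprod.inr (.of i) :
        FreeGroup PUnit.{u + 1} →* _)

theorem untwist_ofBase (g : ι → G) (x : G) : untwist g (ofBase x) = Coprod.inl x :=
  CoprodI.lift_of (M := CyclicFactors G ι) _ (i := none) x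

theorem untwist_ofCyclic (g : ι → G) (i : ι) :
    untwist g (ofCyclic i (.of .unit)) = Coprod.inl (g i)⁻¹ * Coprod.inr (.of i) :=
  (CoprodI.lift_of (M := CyclicFactors G ι) _ (i := some i) _).trans FreeGroup.lift_apply_of

/-- Injectivity is all that pulling the norm back along `twist` requires. -/
theorem twist_injective (g : ι → G) : Function.Injective (twist g) := by
  have h : (untwist g).comp (twist g) = MonoidHom.id _ := by
    ext x
    · simp [twist, untwist_ofBase]
    · simp only [MonoidHom.coe_comp, Function.comp_apply, twist, Coprod.lift_apply_inr,
        FreeGroup.lift_apply_of, MonoidHom.id_apply]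
      rw [map_mul, untwist_ofBase, untwist_ofCyclic, map_inv, mul_inv_cancel_left]
  exact Function.LeftInverse.injective fun x => DFunLike.congr_fun h x

theorem exists_isInvariantNorm_coprod {N : G → ℝ} (hN : IsInvariantNorm N) (g : ι → G)
    {r : ι → ℝ} (hr : ∀ i, 0 < r i) :
    ∃ N' : Coprod G (FreeGroup ι) → ℝ, IsInvariantNorm N' ∧ (∀ x, N' (Coprod.inl x) = N x) ∧
      ∀ i, N' ((Coprod.inl (g i))⁻¹ * Coprod.inr (.of i)) = r i := by
  have hF := isInvariantNorm_factorNorm hN hr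
  refine ⟨_, (isInvariantNorm_freeProductNorm hF).comap _ (twist_injective g), fun x => ?_,
    fun i => ?_⟩
  · exact freeProductNorm_of hF (i := none) x
  · have h : twist g ((Coprod.inl (g i))⁻¹ * Coprod.inr (.of i)) = ofCyclic i (.of .unit) := by
      simp [twist]
    rw [h]
    refine (freeProductNorm_of hF (i := some i) _).trans ?_
    simp [factorNorm, exponentHom]

/-- The closure of a subgroup is a subgroup, so approximating elements of `G` suffices. -/
theorem IsInvariantNorm.exists_inr_lt {N' : Coprod G (FreeGroup ι) → ℝ}
    (hN' : IsInvariantNorm N')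
    (h : ∀ (x : G) (ε : ℝ), 0 < ε → ∃ i, N' ((Coprod.inl x)⁻¹ * Coprod.inr (.of i)) < ε)
    (x : Coprod G (FreeGroup ι)) {ε : ℝ} (hε : 0 < ε) :
    ∃ f : FreeGroup ι, N' (x⁻¹ * Coprod.inr f) < ε := by
  induction x using Coprod.induction_on generalizing ε with
  | inl x =>
    obtain ⟨i, hi⟩ := h x ε hε
    exact ⟨_, hi⟩
  | inr f => exact ⟨f, by simpa [hN'.one] using hε⟩
  | mul x y hx hy =>
    obtain ⟨f, hf⟩ := hx (half_pos hε)
    obtain ⟨f', hf'⟩ := hy (half_pos hε)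
    refine ⟨f * f', ?_⟩
    have h1 : (x * y)⁻¹ * Coprod.inr (f * f') =
        y⁻¹ * (x⁻¹ * Coprod.inr f) * y * (y⁻¹ * Coprod.inr f') := by
      rw [map_mul]
      group
    have h2 := hN'.mul_le (y⁻¹ * (x⁻¹ * Coprod.inr f) * y) (y⁻¹ * Coprod.inr f')
    rw [hN'.conj_inv] at h2
    rw [h1]
    linarith

end Twisted

/-! ### Construction of the metrics. -/

theorem IsBiInvariant.exists_metricSpace_coprod {G : Type u} [Group G] [MetricSpace G]
    (hG : IsBiInvariant G) {ι : Type*} (g : ι → G) {r : ι → ℝ} (hr : ∀ i, 0 < r i)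
    (h : ∀ (x : G) (ε : ℝ), 0 < ε → ∃ i, dist x (g i) < ε ∧ r i < ε) :
    (∃ _ : MetricSpace (Coprod G (FreeGroup ι)),
      IsBiInvariant (Coprod G (FreeGroup ι)) ∧
      Isometry (Coprod.inl : G →* Coprod G (FreeGroup ι)) ∧
      DenseRange (Coprod.inr : FreeGroup ι →* Coprod G (FreeGroup ι))) ∧
    (∀ K : ℝ, 0 < K → (∀ x y : G, dist x y ≤ K) →
      ∃ _ : MetricSpace (Coprod G (FreeGroup ι)),
        IsBiInvariant (Coprod G (FreeGroup ι)) ∧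
        Isometry (Coprod.inl : G →* Coprod G (FreeGroup ι)) ∧
        DenseRange (Coprod.inr : FreeGroup ι →* Coprod G (FreeGroup ι)) ∧
        ∀ u v : Coprod G (FreeGroup ι), dist u v ≤ K) := by
  obtain ⟨N, hN, hinl, hgen⟩ := exists_isInvariantNorm_coprod hG.isInvariantNorm g hr
  have hlt (x : G) (ε : ℝ) (hε : 0 < ε) :
      ∃ i, N ((Coprod.inl x)⁻¹ * Coprod.inr (.of i)) < ε := by
    obtain ⟨i, hi, hri⟩ := h x (ε / 2) (half_pos hε)
    refine ⟨i, ?_⟩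
    have h1 := hN.mul_le (Coprod.inl (x⁻¹ * g i)) ((Coprod.inl (g i))⁻¹ * Coprod.inr (.of i))
    have h2 : dist 1 (x⁻¹ * g i) = dist x (g i) := by simpa using (hG x 1 1 (x⁻¹ * g i)).symm
    rw [hinl, h2, hgen, map_mul, map_inv, mul_assoc, mul_inv_cancel_left] at h1
    linarith
  have hiso (x y : G) : N ((Coprod.inl x)⁻¹ * Coprod.inl y) = dist x y := by
    rw [← map_inv, ← map_mul, hinl]
    simpa using (hG x 1 1 (x⁻¹ * y)).symm
  -- Density passes to any smaller norm, so this serves both `N` and its truncation.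
  have key (N' : Coprod G (FreeGroup ι) → ℝ) (hN' : IsInvariantNorm N')
      (hle : ∀ x, N' x ≤ N x)
      (hiso' : ∀ x y : G, N' ((Coprod.inl x)⁻¹ * Coprod.inl y) = dist x y) :
      letI := hN'.metricSpace
      IsBiInvariant (Coprod G (FreeGroup ι)) ∧
        Isometry (Coprod.inl : G →* Coprod G (FreeGroup ι)) ∧
        DenseRange (Coprod.inr : FreeGroup ι →* Coprod G (FreeGroup ι)) := by
    let := hN'.metricSpace
    refine ⟨hN'.isBiInvariant_dist, Isometry.of_dist_eq hiso', ?_⟩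
    refine Metric.denseRange_iff.2 fun x ε hε => ?_
    exact hN'.exists_inr_lt
      (fun x ε hε => (hlt x ε hε).imp fun i hi => (hle _).trans_lt hi) x hε
  refine ⟨⟨hN.metricSpace, key N hN (fun _ => le_rfl) hiso⟩, fun K hK hd => ?_⟩
  have hN' := hN.truncate hK
  obtain ⟨h1, h2, h3⟩ := key _ hN' (fun _ => min_le_left _ _)
    (fun x y => by rw [hiso, min_eq_left (hd x y)])
  exact ⟨hN'.metricSpace, h1, h2, h3, fun u v => min_le_right _ _⟩

/-- The factor `ℕ` repeats each point of `s` with radii tending to `0`. -/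
theorem IsBiInvariant.exists_metricSpace_coprod_of_dense {G : Type u} [Group G] [MetricSpace G]
    (hG : IsBiInvariant G) {s : Set G} (hs : Dense s) {ι : Type*} (e : ι ≃ s × ℕ) :
    (∃ _ : MetricSpace (Coprod G (FreeGroup ι)),
      IsBiInvariant (Coprod G (FreeGroup ι)) ∧
      Isometry (Coprod.inl : G →* Coprod G (FreeGroup ι)) ∧
      DenseRange (Coprod.inr : FreeGroup ι →* Coprod G (FreeGroup ι))) ∧
    (∀ K : ℝ, 0 < K → (∀ x y : G, dist x y ≤ K) →
      ∃ _ : MetricSpace (Coprod G (FreeGroup ι)),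
        IsBiInvariant (Coprod G (FreeGroup ι)) ∧
        Isometry (Coprod.inl : G →* Coprod G (FreeGroup ι)) ∧
        DenseRange (Coprod.inr : FreeGroup ι →* Coprod G (FreeGroup ι)) ∧
        ∀ u v : Coprod G (FreeGroup ι), dist u v ≤ K) := by
  refine hG.exists_metricSpace_coprod (fun i => ((e i).1 : G))
    (r := fun i => 1 / (((e i).2 : ℝ) + 1)) (fun i => by positivity) fun x ε hε => ?_
  obtain ⟨y, hy, hxy⟩ := hs.exists_dist_lt x hε
  obtain ⟨n, hn⟩ := exists_nat_one_div_lt hε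
  exact ⟨e.symm (⟨y, hy⟩, n), by simpa using hxy, by simpa using hn⟩

theorem mainTheorem4 {G : Type u} [Group G] [MetricSpace G] (hG : IsBiInvariant G) :
    (SeparableSpace G →
      (∃ _ : MetricSpace (Monoid.Coprod G (FreeGroup ℕ)),
          IsBiInvariant (Monoid.Coprod G (FreeGroup ℕ)) ∧
          Isometry (Monoid.Coprod.inl : G →* Monoid.Coprod G (FreeGroup ℕ)) ∧
          DenseRange (Monoid.Coprod.inr : FreeGroup ℕ →* Monoid.Coprod G (FreeGroup ℕ))) ∧
      (∀ K : ℝ, 0 < K → (∀ x y : G, dist x y ≤ K) →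
        ∃ _ : MetricSpace (Monoid.Coprod G (FreeGroup ℕ)),
          IsBiInvariant (Monoid.Coprod G (FreeGroup ℕ)) ∧
          Isometry (Monoid.Coprod.inl : G →* Monoid.Coprod G (FreeGroup ℕ)) ∧
          DenseRange (Monoid.Coprod.inr : FreeGroup ℕ →* Monoid.Coprod G (FreeGroup ℕ)) ∧
          ∀ u v : Monoid.Coprod G (FreeGroup ℕ), dist u v ≤ K)) ∧
    (∀ (κ : Cardinal.{u}) (ι : Type u), ℵ₀ ≤ κ → density G = κ → #ι = κ →
      (∃ _ : MetricSpace (Monoid.Coprod G (FreeGroup ι)),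
          IsBiInvariant (Monoid.Coprod G (FreeGroup ι)) ∧
          Isometry (Monoid.Coprod.inl : G →* Monoid.Coprod G (FreeGroup ι)) ∧
          DenseRange (Monoid.Coprod.inr : FreeGroup ι →* Monoid.Coprod G (FreeGroup ι))) ∧
      (∀ K : ℝ, 0 < K → (∀ x y : G, dist x y ≤ K) →
        ∃ _ : MetricSpace (Monoid.Coprod G (FreeGroup ι)),
          IsBiInvariant (Monoid.Coprod G (FreeGroup ι)) ∧
          Isometry (Monoid.Coprod.inl : G →* Monoid.Coprod G (FreeGroup ι)) ∧
          DenseRange (Monoid.Coprod.inr : FreeGroup ι →* Monoid.Coprod G (FreeGroup ι)) ∧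
          ∀ u v : Monoid.Coprod G (FreeGroup ι), dist u v ≤ K)) := by
  refine ⟨fun hsep => ?_, fun κ ι hκ hd hι => ?_⟩
  · obtain ⟨s, hs, hdense⟩ := exists_countable_dense G
    have := hs.to_subtype
    -- Nonemptiness of `s` makes `s × ℕ` infinite, even when `s` is finite.
    have := hdense.nonempty.to_subtype
    obtain ⟨e⟩ := nonempty_equiv_of_countable (α := ℕ) (β := s × ℕ)
    exact hG.exists_metricSpace_coprod_of_dense hdense e
  · obtain ⟨s, hs, hcard⟩ : ∃ s : Set G, Dense s ∧ #s = density G :=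
      csInf_mem (s := {c | ∃ s : Set G, Dense s ∧ #s = c}) ⟨_, Set.univ, dense_univ, rfl⟩
    -- Since `κ` is infinite, `κ * ℵ₀ = κ`.
    have hcard' : #ι = #(s × ℕ) := by
      rw [mk_prod, hcard, hd, hι, mk_nat]
      simp [mul_aleph0_eq hκ]
    obtain ⟨e⟩ := Cardinal.eq.1 hcard'
    exact hG.exists_metricSpace_coprod_of_dense hs e
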